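/- Let $G$ be a simple graph (possibly infinite), with graph distance $d$ ($d=\infty$ between different components). In the game with parameters $(k,s_c,\rho,s_r,R)$ and centre $v\in V(G)$, $k$ cops choose initial vertices $c_0^1,\dots,c_0^k$; then, knowing these, the robber chooses an initial vertex $r_0$. In stage $i\ge 1$, first each cop $j$ moves from $c_{i-1}^j$ to a vertex $c_i^j$ with $d(c_{i-1}^j,c_i^j)\le s_c$; the robber is captured if $d(r_{i-1},c_i^j)\le\rho$ for some $j$; otherwise the robber moves from $r_{i-1}$ to a vertex $r_i$ along a path of length at most $s_r$ all of whose vertices are at distance larger than $\rho$ from all of $c_i^1,\dots,c_i^k$. All positions are known to both players. In the *original game* the cops win if the robber is captured or there is $N$ with $d(v,r_i)>R$ for all $i\ge N$. In the *divergence game* the cops win if the robber is captured or $d(v,r_i)>R$ for some $i\ge 0$; that is, the robber wins iff he is never captured and stays in the ball of radius $R$ around $v$ forever. For each of the two games, say that $k$ cops win with parameters $(s_c,\rho,s_r,R)$ if for every $v\in V(G)$ they have a winning strategy. The *weak* number of the game is the infimum in $\mathbb N\cup\{\infty\}$ of the $k$ such that $$\exists s_c\ge 1\ \exists \rho\ge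 0\ \forall s_r\ge 1\ \forall R\ge 1:\ k \text{ cops win with parameters } (s_c,\rho,s_r,R),$$ and the *strong* number is the infimum of the $k$ such that $$\exists s_c\ge 1\ \forall s_r\ge 1\ \exists \rho\ge 0\ \forall R\ge 1:\ k \text{ cops win with parameters } (s_c,\rho,s_r,R).$$ Let $\mathrm{wco}(G)$, $\mathrm{sco}(G)$ be the weak and strong numbers of the original game, and $\mathrm{wdi}(G)$, $\mathrm{sdi}(G)$ those of the divergence game. **Theorem.** For any graph $G$, $\mathrm{sdi}(G)=1$ if and only if $\mathrm{sco}(G)=1$, and $\mathrm{wdi}(G)=1$ if and only if $\mathrm{wco}(G)=1$. The same two equivalences hold if, in the divergence game, the robber does not announce $R$ in advance, i.e. if he wins iff he is never captured and $\sup_i d(v,r_i)<\infty$. -/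

import Mathlib

namespace CoarseCops

variable {V : Type*}

/-- A (deterministic) strategy for `k` cops, as a function of the past positions of the robber:
`σ []` is the initial position `c_0` of the cops (chosen before the robber enters the game), and
`σ [r_0, …, r_{i-1}]` is the position `c_i` that the cops occupy after their `i`-th move. -/
abbrev CopStrategy (V : Type*) (k : ℕ) := List V → Fin k → V

/-- In every move, each cop travels a distance at most `sc`. -/
def CopStrategy.HasSpeed (G : SimpleGraph V) {k : ℕ} (σ : CopStrategy V k) (sc : ℕ) : Prop :=
  ∀ (h : List V) (x : V) (j : Fin k), G.edist (σ h j) (σ (h ++ [x]) j) ≤ sc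

/-- The positions `c_i` of the cops when they follow `σ` against the robber's positions
`r 0, r 1, …`; only `r 0, …, r (i - 1)` matter. -/
def CopStrategy.pos {k : ℕ} (σ : CopStrategy V k) (r : ℕ → V) (i : ℕ) : Fin k → V :=
  σ ((List.range i).map r)

/-- The robber can move from `x` to `y` with speed `sr` against cops of reach `ρ` located at `c`:
there is a path of length at most `sr` from `x` to `y`, all of whose vertices are at distance
larger than `ρ` from all cops. -/
def RobberMove (G : SimpleGraph V) {k : ℕ} (ρ sr : ℕ) (c : Fin k → V) (x y : V) : Prop :=
  ∃ p : G.Walk x y, p.IsPath ∧ p.length ≤ sr ∧ ∀ w ∈ p.support, ∀ j, (ρ : ℕ∞) < G.edist w (c j)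

/-- `r 0, r 1, …` is an infinite play of the robber against `σ` in which he is never captured.
In stage `i + 1` the cops move to `c_{i+1}`, the robber, located at `r i`, is captured if some cop
is at distance at most `ρ` from him, and otherwise he moves from `r i` to `r (i + 1)`. -/
def Evades (G : SimpleGraph V) {k : ℕ} (ρ sr : ℕ) (σ : CopStrategy V k) (r : ℕ → V) : Prop :=
  ∀ i : ℕ, (∀ j, (ρ : ℕ∞) < G.edist (r i) (σ.pos r (i + 1) j)) ∧
    RobberMove G ρ sr (σ.pos r (i + 1)) (r i) (r (i + 1))

/-- `k` cops of speed `sc` and reach `ρ` have a strategy against a robber of speed `sr` which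
guarantees that either the robber is captured, or his sequence of positions satisfies `goal`. -/
def CopsCanForce (G : SimpleGraph V) (k sc ρ sr : ℕ) (goal : (ℕ → V) → Prop) : Prop :=
  ∃ σ : CopStrategy V k, σ.HasSpeed G sc ∧ ∀ r : ℕ → V, Evades G ρ sr σ r → goal r

/-- `CopWin(k, sc, ρ, sr, R)`: for every vertex `v`, the cops can eventually protect the `R`-ball
centered at `v`. -/
def CopWin (G : SimpleGraph V) (k sc ρ sr R : ℕ) : Prop :=
  ∀ v : V, CopsCanForce G k sc ρ sr fun r => ∃ N : ℕ, ∀ i ≥ N, (R : ℕ∞) < G.edist v (r i)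

/-- The divergence game: for every vertex `v`, the cops can prevent the robber from staying
forever in the `R`-ball centered at `v`. -/
def DivWin (G : SimpleGraph V) (k sc ρ sr R : ℕ) : Prop :=
  ∀ v : V, CopsCanForce G k sc ρ sr fun r => ∃ i : ℕ, (R : ℕ∞) < G.edist v (r i)

/-- The divergence game in which no radius is announced: for every vertex `v`, the cops can
prevent the robber from staying forever in some ball (of any finite radius) centered at `v`. -/
def UnannouncedDivWin (G : SimpleGraph V) (k sc ρ sr : ℕ) : Prop :=
  ∀ v : V, CopsCanForce G k sc ρ sr fun r => ∀ R : ℕ, ∃ i : ℕ, (R : ℕ∞) < G.edist v (r i)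

/-- The parameters are chosen in the order `sc, ρ, sr, R`, the first two by the cops and the last
two by the robber; `win k sc ρ sr R` says that `k` cops win with these parameters. The value is
the infimum of the `k` for which `k` cops win, and `⊤` if there is no such `k`. -/
noncomputable def weakNumber (win : ℕ → ℕ → ℕ → ℕ → ℕ → Prop) : ℕ∞ :=
  ⨅ (k : ℕ) (_ : ∃ sc > 0, ∃ ρ, ∀ sr > 0, ∀ R > 0, win k sc ρ sr R), (k : ℕ∞)

/-- The parameters are chosen in the order `sc, sr, ρ, R`: `sc` and `ρ` by the cops, `sr` and `R`
by the robber. -/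
noncomputable def strongNumber (win : ℕ → ℕ → ℕ → ℕ → ℕ → Prop) : ℕ∞ :=
  ⨅ (k : ℕ) (_ : ∃ sc > 0, ∀ sr > 0, ∃ ρ, ∀ R > 0, win k sc ρ sr R), (k : ℕ∞)

/-- The weak cop number. -/
noncomputable def wco (G : SimpleGraph V) : ℕ∞ := weakNumber (CopWin G)

/-- The strong cop number. -/
noncomputable def sco (G : SimpleGraph V) : ℕ∞ := strongNumber (CopWin G)

/-- The weak divergence cop number. -/
noncomputable def wdi (G : SimpleGraph V) : ℕ∞ := weakNumber (DivWin G)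

/-- The strong divergence cop number. -/
noncomputable def sdi (G : SimpleGraph V) : ℕ∞ := strongNumber (DivWin G)

/-- The weak divergence cop number, when the robber need not announce the radius of the ball. -/
noncomputable def wdiUnannounced (G : SimpleGraph V) : ℕ∞ :=
  weakNumber fun k sc ρ sr _ => UnannouncedDivWin G k sc ρ sr

/-- The strong divergence cop number, when the robber need not announce the radius of the ball. -/
noncomputable def sdiUnannounced (G : SimpleGraph V) : ℕ∞ :=
  strongNumber fun k sc ρ sr _ => UnannouncedDivWin G k sc ρ sr

end CoarseCops

namespace CoarseCops

variable {V : Type*}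

/-! ### Distances and walks -/

/-! Every game considered lies between the divergence game and the task of driving the robber out of
every ball for good. So for nonempty `V` it suffices that one cop who wins the divergence game can,
perhaps with a larger speed and reach, drive the robber away (`strongNumber_eq_one_iff`,
`weakNumber_eq_one_iff`).

The obstruction is a fat quadrangle. On one whose sides can be traversed in `T` stages and whose
opposite sides are far apart compared with `T * sc` and `ρ`, the robber looks at the cop every `T`
stages and moves on to a side she cannot reach soon (`exists_not_divWin_of_fatQuadrangle`). He stays
in a fixed ball, so a winning cop excludes such quadrangles.

Without them, the cop starts at `v` and in stage `i` occupies the `i`-th vertex of a geodesic from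
`v` to the robber. While he is not captured, he is farther from `v` than the number of completed
stages. She needs only that corresponding points of the geodesics to consecutive robber positions
are boundedly close. In the weak game, quadrangles of one fatness are excluded for all lengths; this
gives a bottleneck property as in quasi-trees (`exists_mem_support_dist_le`). In the strong game,
fatness proportional to length is excluded at large scales; this makes geodesics fellow-travel as in
hyperbolic graphs (`exists_fatQuadrangle_of_geodesics`). -/

theorem edist_le_add {G : SimpleGraph V} {a b c : V} {m n k : ℕ} (hab : G.edist a b ≤ m)
    (hbc : G.edist b c ≤ n) (h : m + n ≤ k) : G.edist a c ≤ k :=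
  calc G.edist a c ≤ G.edist a b + G.edist b c := SimpleGraph.edist_triangle
    _ ≤ (m : ℕ∞) + n := add_le_add hab hbc
    _ ≤ k := by exact_mod_cast h

theorem lt_edist_of_lt {G : SimpleGraph V} {w u c : V} {k m n : ℕ} (hwu : (m : ℕ∞) < G.edist w u)
    (huc : G.edist u c ≤ n) (h : k + n ≤ m) : (k : ℕ∞) < G.edist w c := by
  by_contra! hwc
  exact absurd (edist_le_add hwc (SimpleGraph.edist_comm (G := G) ▸ huc) h) (not_le.2 hwu)

theorem edist_le_length_of_mem {G : SimpleGraph V} {u v w : V} (p : G.Walk u v)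
    (hw : w ∈ p.support) : G.edist u w ≤ p.length := by
  classical
  exact (SimpleGraph.edist_le (p.takeUntil w hw)).trans
    (by exact_mod_cast p.length_takeUntil_le_length hw)

theorem RobberMove.of_walk {G : SimpleGraph V} {k ρ sr : ℕ} {c : Fin k → V} {x y : V}
    (p : G.Walk x y) (hp : p.length ≤ sr)
    (h : ∀ w ∈ p.support, ∀ j, (ρ : ℕ∞) < G.edist w (c j)) : RobberMove G ρ sr c x y := by
  classical
  exact ⟨p.bypass, p.bypass_isPath, p.length_bypass_le_length.trans hp,
    fun w hw => h w (p.support_bypass_subset_support hw)⟩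

theorem exists_walk_of_adj {G : SimpleGraph V} (f : ℕ → V) {a b : ℕ} (hab : a ≤ b)
    (h : ∀ t, a ≤ t → t < b → G.Adj (f t) (f (t + 1))) :
    ∃ p : G.Walk (f a) (f b), p.length = b - a ∧
      ∀ w ∈ p.support, ∃ t, a ≤ t ∧ t ≤ b ∧ w = f t := by
  induction b, hab using Nat.le_induction with
  | base => exact ⟨.nil, by simp, fun w hw => ⟨a, le_rfl, le_rfl, by simpa using hw⟩⟩
  | succ b hab ih =>
    obtain ⟨p, hp, hs⟩ := ih fun t h1 h2 => h t h1 (by omega)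
    refine ⟨p.concat (h b hab (by omega)), by simp [hp]; omega, fun w hw => ?_⟩
    rw [SimpleGraph.Walk.support_concat] at hw
    rcases List.mem_append.1 hw with hw | hw
    · obtain ⟨t, h1, h2, rfl⟩ := hs w hw
      exact ⟨t, h1, by omega, rfl⟩
    · exact ⟨b + 1, by omega, le_rfl, by simpa using hw⟩

/-! ### The robber on a fat quadrangle -/

/-- A closed walk made of four walks of length at most `L`, opposite ones of which are at distance
larger than `K`. -/
def FatQuadrangle (G : SimpleGraph V) (K L : ℕ) : Prop :=
  ∃ (a : Fin 4 → V) (W : ∀ i, G.Walk (a i) (a (i + 1))), (∀ i, (W i).length ≤ L) ∧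
    ∀ i, ∀ x ∈ (W i).support, ∀ y ∈ (W (i + 2)).support, (K : ℕ∞) < G.edist x y

theorem FatQuadrangle.of_walks {G : SimpleGraph V} {K L : ℕ} {a b c d : V}
    (P : G.Walk a b) (S : G.Walk b c) (Q : G.Walk c d) (T : G.Walk d a)
    (hP : P.length ≤ L) (hS : S.length ≤ L) (hQ : Q.length ≤ L) (hT : T.length ≤ L)
    (hPQ : ∀ x ∈ P.support, ∀ y ∈ Q.support, (K : ℕ∞) < G.edist x y)
    (hST : ∀ x ∈ S.support, ∀ y ∈ T.support, (K : ℕ∞) < G.edist x y) : FatQuadrangle G K L := by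
  let A : Fin 4 → V := ![a, b, c, d]
  let W : ∀ i, G.Walk (A i) (A (i + 1)) := fun i => match i with
    | 0 => P
    | 1 => S
    | 2 => Q
    | 3 => T
  refine ⟨A, W, fun i => ?_, fun i => ?_⟩
  · match i with
    | 0 => exact hP
    | 1 => exact hS
    | 2 => exact hQ
    | 3 => exact hT
  · match i with
    | 0 => exact hPQ
    | 1 => exact hST
    | 2 => exact fun x hx y hy => SimpleGraph.edist_comm (G := G) ▸ hPQ y hy x hx
    | 3 => exact fun x hx y hy => SimpleGraph.edist_comm (G := G) ▸ hST y hy x hx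

theorem FatQuadrangle.mono {G : SimpleGraph V} {K K' L L' : ℕ} (h : FatQuadrangle G K L)
    (hK : K' ≤ K) (hL : L ≤ L') : FatQuadrangle G K' L' := by
  obtain ⟨a, W, h1, h2⟩ := h
  exact ⟨a, W, fun i => (h1 i).trans hL,
    fun i x hx y hy => lt_of_le_of_lt (by exact_mod_cast hK) (h2 i x hx y hy)⟩

/-- A robber who can always reply so as to maintain the relation `J` between his position and
that of the only cop stays in the ball forever. -/
theorem not_copsCanForce_one_of_invariant {G : SimpleGraph V} {sc ρ sr R : ℕ} {v : V}
    (J : V → V → Prop) (hstart : ∀ c, ∃ x, J x c)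
    (hstep : ∀ x c c', J x c → G.edist c c' ≤ sc →
      (ρ : ℕ∞) < G.edist x c' ∧ ∃ x', RobberMove G ρ sr (fun _ : Fin 1 => c') x x' ∧ J x' c')
    (hball : ∀ x c, J x c → G.edist v x ≤ R) :
    ¬ CopsCanForce G 1 sc ρ sr fun r => ∃ i : ℕ, (R : ℕ∞) < G.edist v (r i) := by
  rintro ⟨σ, hσ, hwin⟩
  obtain ⟨x₀, hx₀⟩ := hstart (σ [] 0)
  have hnext : ∀ s : {s : List V × V // J s.2 (σ s.1 0)}, ∃ x',
      RobberMove G ρ sr (fun _ : Fin 1 => σ (s.1.1 ++ [s.1.2]) 0) s.1.2 x' ∧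
        J x' (σ (s.1.1 ++ [s.1.2]) 0) := fun s => (hstep _ _ _ s.2 (hσ _ _ _)).2
  choose next hmove hJ using hnext
  -- The state carries the robber's past along with his position, since the cop's strategy depends
  -- on the whole past.
  let st : ℕ → {s : List V × V // J s.2 (σ s.1 0)} := fun n =>
    Nat.rec ⟨([], x₀), hx₀⟩ (fun _ s => ⟨(s.1.1 ++ [s.1.2], next s), hJ s⟩) n
  let r : ℕ → V := fun n => (st n).1.2
  have hhist : ∀ n, (st n).1.1 = (List.range n).map r := by
    intro n
    induction n with
    | zero => rfl
    | succ n ih =>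
      rw [List.range_succ, List.map_append, ← ih]
      rfl
  have hpos : ∀ n, (fun _ : Fin 1 => σ ((st n).1.1 ++ [(st n).1.2]) 0) = σ.pos r (n + 1) := by
    intro n
    funext j
    rw [CopStrategy.pos, ← hhist (n + 1), Subsingleton.elim j 0]
  obtain ⟨i, hi⟩ := hwin r fun n => by
    rw [← hpos n]
    exact ⟨fun _ => (hstep _ _ _ (st n).2 (hσ _ _ _)).1, hmove (st n)⟩
  exact absurd (hball _ _ (st i).2) (not_le.2 hi)

/-- A walk is unhit if it avoids the ball of radius `m` around `u`. -/
def Unhit (G : SimpleGraph V) {x y : V} (p : G.Walk x y) (u : V) (m : ℕ) : Prop :=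
  ∀ w ∈ p.support, (m : ℕ∞) < G.edist w u

/-- Two points of a ball of radius `m` are at distance at most `2 * m`, so the ball cannot meet both
walks. -/
theorem unhit_or_unhit {G : SimpleGraph V} {x y x' y' : V} {p : G.Walk x y} {q : G.Walk x' y'}
    {K m : ℕ} (h : ∀ w ∈ p.support, ∀ z ∈ q.support, (K : ℕ∞) < G.edist w z) (hm : 2 * m ≤ K)
    (u : V) : Unhit G p u m ∨ Unhit G q u m := by
  by_contra! hc
  simp only [Unhit] at hc
  push Not at hc
  obtain ⟨⟨w, hw, hwu⟩, ⟨z, hz, hzu⟩⟩ := hc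
  exact absurd (edist_le_add hwu (SimpleGraph.edist_comm (G := G) ▸ hzu) (by omega))
    (not_le.2 (h w hw z hz))

/-- A robber of speed `sr` evades a cop of speed `sc` and reach `ρ` on a quadrangle that is
fat enough in comparison to its length. -/
theorem exists_not_divWin_of_fatQuadrangle {G : SimpleGraph V} {sc ρ sr T : ℕ} (hT : 0 < T)
    (hQ : FatQuadrangle G (2 * (ρ + 2 * (T * sc))) (T * sr)) :
    ∃ R > 0, ¬ DivWin G 1 sc ρ sr R := by
  classical
  obtain ⟨a, W, hlen, hfar⟩ := hQ
  set L := T * sr with hL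
  have hW : ∀ i, ∀ w ∈ (W i).support, G.edist (a i) w ≤ L := fun i w hw =>
    (edist_le_length_of_mem _ hw).trans (by exact_mod_cast hlen i)
  have ha : ∀ i, G.edist (a i) (a (i + 1)) ≤ L := fun i => hW i _ (W i).end_mem_support
  have ha0 : ∀ i, G.edist (a 0) (a i) ≤ (3 * L : ℕ) := by
    have h1 : G.edist (a 0) (a 1) ≤ L := ha 0
    have h2 : G.edist (a 0) (a 2) ≤ (2 * L : ℕ) := edist_le_add h1 (ha 1) (by omega)
    have h3 : G.edist (a 0) (a 3) ≤ (3 * L : ℕ) := edist_le_add h2 (ha 2) (by omega)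
    intro i
    match i with
    | 0 => simp
    | 1 => exact h1.trans (by exact_mod_cast (by omega))
    | 2 => exact h2.trans (by exact_mod_cast (by omega))
    | 3 => exact h3
  have hball : ∀ i, ∀ w ∈ (W i).support, G.edist (a 0) w ≤ (4 * L + 1 : ℕ) := fun i w hw =>
    edist_le_add (ha0 i) (hW i w hw) (by omega)
  -- A side chosen with margin `m₂` has margin `m₁` left after `T` stages, when the robber arrives;
  -- this lasts for the `T` stages of his next passage.
  set m₁ := ρ + T * sc with hm₁
  set m₂ := ρ + 2 * (T * sc) with hm₂
  -- From an unhit side the robber reaches another side that remains unhit.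
  have hescape : ∀ i, ∀ x ∈ (W i).support, ∀ u, Unhit G (W i) u m₁ →
      ∃ k, ∃ y ∈ (W k).support, Unhit G (W k) u m₂ ∧ ∃ p : G.Walk x y, p.length ≤ L ∧
        Unhit G p u m₁ ∧ ∀ w ∈ p.support, w ∈ (W i).support := by
    intro i x hx u hu
    -- The two neighbours of side `i` are opposite each other, so one is unhit; the robber walks
    -- along side `i` to the common corner.
    rcases unhit_or_unhit (hfar (i + 1)) le_rfl u with h | h
    · refine ⟨i + 1, a (i + 1), (W (i + 1)).start_mem_support, h, (W i).dropUntil x hx,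
        ((W i).length_dropUntil_le_length hx).trans (hlen i), fun w hw => ?_, fun w hw => ?_⟩
      · exact hu w ((W i).support_dropUntil_subset_support hx hw)
      · exact (W i).support_dropUntil_subset_support hx hw
    · have e : i + 1 + 2 + 1 = i := by rw [add_assoc, add_assoc]; simp
      refine ⟨i + 1 + 2, a i, ?_, h, ((W i).takeUntil x hx).reverse, ?_,
        fun w hw => ?_, fun w hw => ?_⟩
      · exact congrArg a e ▸ (W (i + 1 + 2)).end_mem_support
      · rw [SimpleGraph.Walk.length_reverse]
        exact ((W i).length_takeUntil_le_length hx).trans (hlen i)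
      · exact hu w ((W i).support_takeUntil_subset_support hx (by simpa using hw))
      · exact (W i).support_takeUntil_subset_support hx (by simpa using hw)
  refine ⟨4 * L + 1, by omega, fun hdiv => ?_⟩
  -- Here `u` is the cop's position at the robber's last decision, `j` stages ago, and `p` is what
  -- remains of his planned walk.
  let J : V → V → Prop := fun x c => ∃ u j, j ≤ T ∧ G.edist u c ≤ (j * sc : ℕ) ∧
    ∃ k, ∃ y ∈ (W k).support, Unhit G (W k) u m₂ ∧ ∃ p : G.Walk x y, p.length ≤ (T - j) * sr ∧
      Unhit G p u m₁ ∧ ∀ w ∈ p.support, ∃ i, w ∈ (W i).support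
  refine not_copsCanForce_one_of_invariant (v := a 0) J (fun c => ?_) (fun x c c' hJ hc => ?_)
    (fun x c hJ => ?_) (hdiv (a 0))
  · have hc : ∃ k, Unhit G (W k) c m₂ := by
      rcases unhit_or_unhit (hfar 0) le_rfl c with h | h
      · exact ⟨_, h⟩
      · exact ⟨_, h⟩
    obtain ⟨k, hk⟩ := hc
    refine ⟨a k, c, 0, by omega, by simp, k, a k, (W k).start_mem_support, hk, .nil, by simp, ?_, ?_⟩
    · intro w hw
      rw [SimpleGraph.Walk.support_nil, List.mem_singleton] at hw
      subst hw
      exact lt_of_le_of_lt (by exact_mod_cast (by omega)) (hk _ (W k).start_mem_support)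
    · intro w hw
      rw [SimpleGraph.Walk.support_nil, List.mem_singleton] at hw
      subst hw
      exact ⟨k, (W k).start_mem_support⟩
  · have hJ' : ∃ u j, j < T ∧ G.edist u c ≤ (j * sc : ℕ) ∧
        ∃ k, ∃ y ∈ (W k).support, Unhit G (W k) u m₂ ∧ ∃ p : G.Walk x y,
          p.length ≤ (T - j) * sr ∧ Unhit G p u m₁ ∧
            ∀ w ∈ p.support, ∃ i, w ∈ (W i).support := by
      obtain ⟨u, j, hj, huc, k, y, hy, hk, p, hp, hpu, hpW⟩ := hJ
      rcases hj.lt_or_eq with hj | rfl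
      · exact ⟨u, j, hj, huc, k, y, hy, hk, p, hp, hpu, hpW⟩
      -- At `j = T` the plan is used up, and a new decision is made from the cop's current position.
      · obtain rfl : x = y := p.eq_of_length_eq_zero (by simpa using hp)
        obtain ⟨k', y', hy', hk', p', hp', hpu', hpW'⟩ := hescape k x hy c fun w hw =>
          lt_edist_of_lt (hk w hw) huc (by omega)
        exact ⟨c, 0, hT, by simp, k', y', hy', hk', p', by simpa using hp', hpu',
          fun w hw => ⟨k, hpW' w hw⟩⟩
    obtain ⟨u, j, hj, huc, k, y, hy, hk, p, hp, hpu, hpW⟩ := hJ'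
    have huc' : G.edist u c' ≤ ((j + 1) * sc : ℕ) := edist_le_add huc hc (by rw [add_one_mul])
    have hjT : (j + 1) * sc ≤ T * sc := Nat.mul_le_mul_right _ hj
    have hfree : ∀ w ∈ p.support, (ρ : ℕ∞) < G.edist w c' := fun w hw =>
      lt_edist_of_lt (hpu w hw) huc' (by omega)
    have hdrop : ∀ w ∈ (p.drop sr).support, w ∈ p.support := fun w hw =>
      (p.isSubwalk_drop sr).support_subset hw
    refine ⟨hfree x p.start_mem_support, p.getVert sr, RobberMove.of_walk (p.take sr) (by simp)
      fun w hw _ => hfree w ((p.isSubwalk_take sr).support_subset hw), u, j + 1, hj, huc', k, y, hy,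
      hk, p.drop sr, ?_, fun w hw => hpu w (hdrop w hw), fun w hw => hpW w (hdrop w hw)⟩
    have : (T - j) * sr = (T - (j + 1)) * sr + sr := by
      rw [← add_one_mul]; congr 1; omega
    rw [SimpleGraph.Walk.drop_length]
    omega
  · obtain ⟨u, j, hj, huc, k, y, hy, hk, p, hp, hpu, hpW⟩ := hJ
    obtain ⟨i, hi⟩ := hpW x p.start_mem_support
    exact hball i x hi

/-! ### Geodesics -/

/-- The restriction of `f` to `{0, …, n}` is a geodesic. -/
def IsGeodesicUpTo (G : SimpleGraph V) (f : ℕ → V) (n : ℕ) : Prop :=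
  ∀ s t, s ≤ t → t ≤ n → G.dist (f s) (f t) = t - s

namespace IsGeodesicUpTo

variable {G : SimpleGraph V} {f : ℕ → V} {n : ℕ}

theorem mono (hf : IsGeodesicUpTo G f n) {m : ℕ} (h : m ≤ n) : IsGeodesicUpTo G f m :=
  fun s t hst ht => hf s t hst (ht.trans h)

theorem adj (hf : IsGeodesicUpTo G f n) {t : ℕ} (ht : t < n) : G.Adj (f t) (f (t + 1)) :=
  SimpleGraph.dist_eq_one_iff_adj.1 (by rw [hf t (t + 1) (by omega) ht]; omega)

theorem reachable (hf : IsGeodesicUpTo G f n) {t : ℕ} (ht : t ≤ n) : G.Reachable (f 0) (f t) := by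
  rcases Nat.eq_zero_or_pos t with rfl | h
  · exact .refl _
  · exact .of_dist_ne_zero (by rw [hf 0 t (by omega) ht]; omega)

end IsGeodesicUpTo

theorem dist_getVert_le {G : SimpleGraph V} {u v : V} (p : G.Walk u v) {s t : ℕ} (h : s ≤ t) :
    G.dist (p.getVert s) (p.getVert t) ≤ t - s := by
  have h1 := (SimpleGraph.dist_le ((p.drop s).take (t - s))).trans
    ((SimpleGraph.Walk.take_length _ _).trans_le (min_le_left _ _))
  rwa [SimpleGraph.Walk.drop_getVert, Nat.add_sub_cancel' h] at h1

theorem reachable_getVert {G : SimpleGraph V} {u v : V} (p : G.Walk u v) (t : ℕ) :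
    G.Reachable u (p.getVert t) :=
  (p.take t).reachable

/-- The pieces before `s`, between `s` and `t`, and after `t` have distances bounded by their
lengths; the total is `dist u v`, so all bounds are tight. -/
theorem isGeodesicUpTo_getVert {G : SimpleGraph V} {u v : V} {p : G.Walk u v}
    (hp : p.length = G.dist u v) : IsGeodesicUpTo G p.getVert p.length := by
  intro s t hst ht
  have h1 := dist_getVert_le p hst
  have h2 := dist_getVert_le p (Nat.zero_le s)
  have h3 := dist_getVert_le p ht
  rw [p.getVert_zero] at h2
  rw [p.getVert_length] at h3
  have h4 := (reachable_getVert p s).dist_triangle_left v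
  have h5 := ((reachable_getVert p s).symm.trans (reachable_getVert p t)).dist_triangle_left v
  omega

theorem dist_le_of_mem_geodesic {G : SimpleGraph V} {u v w : V} (p : G.Walk u v) {n : ℕ}
    (hp : p.length ≤ n) (hw : w ∈ p.support) : G.Reachable u w ∧ G.dist u w ≤ n := by
  classical
  exact ⟨(p.takeUntil w hw).reachable, (SimpleGraph.dist_le (p.takeUntil w hw)).trans
    ((p.length_takeUntil_le_length hw).trans hp)⟩

theorem lt_edist_of_lt_dist {G : SimpleGraph V} {n : ℕ} {x y : V} (h : n < G.dist x y) :
    (n : ℕ∞) < G.edist x y := by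
  have hr : G.Reachable x y := .of_dist_ne_zero (by omega)
  rw [← hr.coe_dist_eq_edist]
  exact_mod_cast h

/-! ### Thin bigons -/

/-- Stop when `h` first falls to `K / 4`, or at `20 * K`. A fall from `K` at rate at most 2 takes at
least `3 * K / 8` steps; otherwise `20 * K` far exceeds `2 * K`. Either way `n` exceeds `h n` by at
least `K / 8`, which later keeps the two short sides of a quadrangle apart. -/
theorem exists_window {h : ℕ → ℕ} {K N : ℕ} (h0 : h 0 = K) (hK : 0 < K)
    (hlip : ∀ n < N, h n ≤ h (n + 1) + 2) (hle : ∀ n ≤ N, n ≤ 20 * K → h n ≤ 2 * K)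
    (hN : 20 * K ≤ N ∨ 4 * h N ≤ K) :
    ∃ n ≤ N, n ≤ 20 * K ∧ 8 * h n + K ≤ 8 * n ∧ ∀ m ≤ n, K ≤ 4 * h m + 8 := by
  classical
  have hex : ∃ n, n ≤ N ∧ (4 * h n ≤ K ∨ n = 20 * K) := by
    rcases hN with hN | hN
    · exact ⟨20 * K, hN, .inr rfl⟩
    · exact ⟨N, le_rfl, .inl hN⟩
  obtain ⟨hnN, hn⟩ := Nat.find_spec hex
  have hmin := fun m => Nat.find_min hex (m := m)
  set n := Nat.find hex
  have hn20 : n ≤ 20 * K := by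
    by_contra! hlt
    exact hmin (20 * K) hlt ⟨by omega, .inr rfl⟩
  have hlow : ∀ m < n, K < 4 * h m := fun m hm => by
    by_contra! hle'
    exact hmin m hm ⟨by omega, .inl hle'⟩
  have hdrop : ∀ m ≤ n, K ≤ h m + 2 * m := by
    intro m
    induction m with
    | zero => intro _; omega
    | succ m ih => intro hm; have := ih (by omega); have := hlip m (by omega); omega
  refine ⟨n, hnN, hn20, ?_, fun m hm => ?_⟩
  · rcases hn with hn | hn
    · have := hdrop n le_rfl
      omega
    · have := hle n hnN hn20
      omega
  · rcases hm.lt_or_eq with hm' | hm'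
    · have := hlow m hm'
      omega
    · rcases Nat.eq_zero_or_pos m with hm | hm
      · rw [hm, h0]; omega
      · have h1 := hlow (m - 1) (by omega)
        have h2 := hlip (m - 1) (by omega)
        rw [Nat.sub_add_cancel hm] at h2
        omega

/-- Two geodesics from the same vertex that are far apart at some time, long before their nearby
ends, span a fat quadrangle. -/
theorem exists_fatQuadrangle_of_geodesics {G : SimpleGraph V} {f g : ℕ → V} {l s t₀ D : ℕ}
    (hf : IsGeodesicUpTo G f l) (hg : IsGeodesicUpTo G g l) (h0 : f 0 = g 0)
    (hl : G.dist (f l) (g l) ≤ 2 * s) (ht₀ : t₀ + 320 * s ≤ l)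
    (hD : D ≤ G.dist (f t₀) (g t₀)) (hD64 : 64 ≤ D) :
    ∃ K ≥ D, FatQuadrangle G (6 * K / 64) (40 * K) := by
  classical
  have rf : ∀ t ≤ l, G.Reachable (f 0) (f t) := fun t ht => hf.reachable ht
  have rg : ∀ t ≤ l, G.Reachable (f 0) (g t) := fun t ht => h0 ▸ hg.reachable ht
  have rff : ∀ a ≤ l, ∀ b ≤ l, G.Reachable (f a) (f b) := fun a ha b hb =>
    (rf a ha).symm.trans (rf b hb)
  have rfg : ∀ a ≤ l, ∀ b ≤ l, G.Reachable (f a) (g b) := fun a ha b hb =>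
    (rf a ha).symm.trans (rg b hb)
  set w : ℕ → ℕ := fun t => G.dist (f t) (g t) with hw
  have hlip1 : ∀ t, t + 1 ≤ l → w t ≤ w (t + 1) + 2 := by
    intro t ht
    have h1 := (rff t (by omega) (t + 1) ht).dist_triangle_left (g t)
    have h2 := (rfg (t + 1) ht (t + 1) ht).dist_triangle_left (g t)
    have h3 := hf t (t + 1) (by omega) ht
    have h4 := hg t (t + 1) (by omega) ht
    rw [G.dist_comm (u := g (t + 1))] at h2
    simp only [hw]
    omega
  have hlip2 : ∀ t, t + 1 ≤ l → w (t + 1) ≤ w t + 2 := by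
    intro t ht
    have h1 := (rff (t + 1) ht t (by omega)).dist_triangle_left (g (t + 1))
    have h2 := (rfg t (by omega) t (by omega)).dist_triangle_left (g (t + 1))
    have h3 := hf t (t + 1) (by omega) ht
    have h4 := hg t (t + 1) (by omega) ht
    rw [G.dist_comm (u := f (t + 1)) (v := f t)] at h1
    simp only [hw]
    omega
  -- Both geodesics start at the same vertex, so `|a - b| ≤ dist (f a) (g b)`; hence each width is
  -- at most twice this distance.
  have hfar : ∀ a ≤ l, ∀ b ≤ l, w a ≤ 2 * G.dist (f a) (g b) ∧ w b ≤ 2 * G.dist (f a) (g b) := by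
    intro a ha b hb
    have h1 := (rfg a ha b hb).dist_triangle_left (g a)
    have h2 := (rff b hb a ha).dist_triangle_left (g b)
    have h3 := (rf b hb).dist_triangle_right (f 0)
    have h4 := (rfg a ha b hb).dist_triangle_right (f 0)
    have h5 := (rfg a ha b hb).symm.dist_triangle_right (f 0)
    have h6 := hf 0 a (by omega) ha
    have h7 := hg 0 b (by omega) hb
    rw [← h0] at h7
    rw [G.dist_comm (u := g b) (v := f a)] at h5
    simp only [hw]
    rcases le_total a b with hab | hab
    · have h8 := hf a b hab hb
      have h9 := hg a b hab hb
      rw [G.dist_comm (u := g b) (v := g a)] at h1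
      rw [G.dist_comm (u := f b) (v := f a)] at h2
      omega
    · have h8 := hf b a hab ha
      have h9 := hg b a hab ha
      omega
  -- a width that is nearly maximal in a large window
  obtain ⟨t, ht, hmax⟩ := (Finset.range (l + 1)).exists_max_image
    (fun t : ℕ => 20 * (w t : ℤ) - |(t : ℤ) - t₀|) ⟨0, by simp⟩
  rw [Finset.mem_range] at ht
  have hmax0 := hmax t₀ (by rw [Finset.mem_range]; omega)
  set K := w t with hKdef
  have hw0 : D ≤ w t₀ := hD
  have hKD : D ≤ K := by
    have := abs_nonneg ((t : ℤ) - t₀)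
    simp only [sub_self, abs_zero] at hmax0
    omega
  have htt₀ : t ≤ t₀ + 20 * K := by
    have := le_abs_self ((t : ℤ) - t₀)
    simp only [sub_self, abs_zero] at hmax0
    omega
  -- Moving by at most `20 * K` changes the penalty by at most `20 * K`, so by maximality the width
  -- grows by at most `K`.
  have hbound : ∀ b ≤ l, b ≤ t + 20 * K → t ≤ b + 20 * K → w b ≤ 2 * K := by
    intro b hb h1 h2
    have h3 := hmax b (by rw [Finset.mem_range]; omega)
    have h4 : |(b : ℤ) - t₀| ≤ |(t : ℤ) - t₀| + 20 * K := by
      have : |(b : ℤ) - t| ≤ 20 * K := by rw [abs_le]; omega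
      have := abs_sub_le (b : ℤ) t t₀
      omega
    omega
  obtain ⟨m, hml, hm20, hmK, hmw⟩ := exists_window (h := fun n => w (t + n)) (K := K) (N := l - t)
    rfl (by omega) (fun n hn => hlip1 (t + n) (by omega))
    (fun n hn hn' => hbound _ (by omega) (by omega) (by omega)) (by
      -- If the width at `l` exceeds `K / 4`, then `K < 8 * s`, so `t + 20 * K ≤ t₀ + 40 * K < t₀ +
      -- 320 * s ≤ l` and the window fits.
      by_contra! hc
      have : t + (l - t) = l := by omega
      have hl' : w l ≤ 2 * s := hl
      simp only [this] at hc
      omega)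
  obtain ⟨n, hnl, hn20, hnK, hnw⟩ := exists_window (h := fun n => w (t - n)) (K := K) (N := t)
    rfl (by omega) (fun n hn => by
      have := hlip2 (t - (n + 1)) (by omega)
      rwa [show t - (n + 1) + 1 = t - n by omega] at this)
    (fun n hn hn' => hbound _ (by omega) (by omega) (by omega)) (by
      right
      simp [hw, h0])
  set a := t - n with ha
  set b := t + m with hb
  have hwab : ∀ c, a ≤ c → c ≤ b → K ≤ 4 * w c + 8 := by
    intro c hac hcb
    rcases le_total t c with htc | htc
    · have := hmw (c - t) (by omega)
      rwa [show t + (c - t) = c by omega] at this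
    · have := hnw (t - c) (by omega)
      rwa [show t - (t - c) = c by omega] at this
  have hal : a ≤ l := by omega
  have hbl : b ≤ l := by omega
  obtain ⟨P, hP, hPf⟩ := exists_walk_of_adj f (show a ≤ b by omega)
    fun c _ hc => hf.adj (by omega)
  obtain ⟨Q, hQ, hQg⟩ := exists_walk_of_adj g (show a ≤ b by omega)
    fun c _ hc => hg.adj (by omega)
  obtain ⟨S, hS⟩ := (rfg b hbl b hbl).exists_walk_length_eq_dist
  obtain ⟨T, hT⟩ := (rfg a hal a hal).symm.exists_walk_length_eq_dist
  have hwa : w a ≤ 2 * K := hbound a hal (by omega) (by omega)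
  have hwb : w b ≤ 2 * K := hbound b hbl (by omega) (by omega)
  have hT' : T.reverse.length ≤ w a := by
    rw [SimpleGraph.Walk.length_reverse, hT, G.dist_comm]
  refine ⟨K, hKD, FatQuadrangle.of_walks P S Q.reverse T (by omega) (by rw [hS]; change w b ≤ _; omega)
    (by rw [SimpleGraph.Walk.length_reverse]; omega)
    (by rw [← SimpleGraph.Walk.length_reverse]; omega) ?_ ?_⟩
  -- Long sides: the distance is at least half a width, thus at least `K / 8 - 1`, which exceeds `6
  -- * K / 64` because `K ≥ 64`.
  · intro x hx y hy
    obtain ⟨c, hac, hcb, rfl⟩ := hPf x hx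
    obtain ⟨d, had, hdb, rfl⟩ := hQg y (by simpa using hy)
    refine lt_edist_of_lt_dist ?_
    have h1 := (hfar c (by omega) d (by omega)).1
    have h2 := hwab c hac hcb
    omega
  -- Short sides: `b - a` exceeds `w a + w b` by at least `K / 4`.
  · intro x hx y hy
    refine lt_edist_of_lt_dist ?_
    obtain ⟨h1, h2⟩ := dist_le_of_mem_geodesic S hS.le hx
    obtain ⟨h3, h4⟩ := dist_le_of_mem_geodesic T.reverse hT' (w := y) (by simpa using hy)
    have h5 := hf a b (by omega) hbl
    have h6 := h3.dist_triangle_left (f b)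
    have h7 := h1.symm.dist_triangle_right y
    rw [G.dist_comm (u := f a)] at h4
    rw [G.dist_comm (u := f a) (v := y)] at h6
    rw [G.dist_comm (u := y) (v := x), G.dist_comm (u := x) (v := f b)] at h7
    have h8 : G.dist (f b) x ≤ w b := h2
    omega

/-! ### Bottlenecks -/

/-- If there is no quadrangle of fatness `F`, then every walk between the ends of a geodesic
comes close to all vertices of this geodesic. -/
theorem exists_mem_support_dist_le {G : SimpleGraph V} {F : ℕ} (hF : ∀ L, ¬ FatQuadrangle G F L)
    {u v : V} {p : G.Walk u v} (hp : p.length = G.dist u v) (q : G.Walk u v) {t : ℕ}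
    (ht : t ≤ p.length) : ∃ z ∈ q.support, G.dist z (p.getVert t) ≤ 3 * (F + 1) := by
  classical
  by_contra! hfar
  -- The extra unit is lost at the extremal times `i` and `j`, where `q` is within `K` of the
  -- geodesic but still farther than `F`.
  set K := F + 1 with hK
  set f := p.getVert with hfdef
  set g := q.getVert with hgdef
  have hf : IsGeodesicUpTo G f p.length := isGeodesicUpTo_getVert hp
  have hgadj : ∀ i, i < q.length → G.Adj (g i) (g (i + 1)) := fun i hi => q.adj_getVert_succ hi
  have rf : ∀ s, G.Reachable u (f s) := reachable_getVert p
  have rg : ∀ i, G.Reachable u (g i) := reachable_getVert q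
  have rfg : ∀ s i, G.Reachable (f s) (g i) := fun s i => (rf s).symm.trans (rg i)
  have hgc : ∀ i, 3 * K < G.dist (g i) (f t) := fun i => hfar _ (q.getVert_mem_support i)
  -- the last time at which `q` is close to the first part of the geodesic
  obtain ⟨i, ⟨him, s₁, hs₁, his₁⟩, himax⟩ : ∃ i, (i ≤ q.length ∧ ∃ s ≤ t, G.dist (g i) (f s) ≤ K) ∧
      ∀ j, i < j → j ≤ q.length → ∀ s ≤ t, K < G.dist (g j) (f s) := by
    have h0 : ∃ s ≤ t, G.dist (g 0) (f s) ≤ K := ⟨0, by omega, by simp [hfdef, hgdef]⟩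
    refine ⟨Nat.findGreatest (fun i => ∃ s ≤ t, G.dist (g i) (f s) ≤ K) q.length,
      ⟨Nat.findGreatest_le _, Nat.findGreatest_spec (P := fun i => ∃ s ≤ t, G.dist (g i) (f s) ≤ K)
        (Nat.zero_le _) h0⟩, fun j hj hjm s hs => ?_⟩
    by_contra! hle
    exact Nat.findGreatest_is_greatest hj hjm ⟨s, hs, hle⟩
  -- the next time at which `q` is close to the second part
  have hex : ∃ j, i ≤ j ∧ j ≤ q.length ∧ ∃ s, t ≤ s ∧ s ≤ p.length ∧ G.dist (g j) (f s) ≤ K :=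
    ⟨q.length, him, le_rfl, p.length, ht, le_rfl, by simp [hfdef, hgdef]⟩
  obtain ⟨j, ⟨hij, hjm, s₂, hs₂, hs₂l, hjs₂⟩, hjmin⟩ : ∃ j, (i ≤ j ∧ j ≤ q.length ∧ ∃ s, t ≤ s ∧
      s ≤ p.length ∧ G.dist (g j) (f s) ≤ K) ∧
      ∀ j', i ≤ j' → j' < j → ∀ s, t ≤ s → s ≤ p.length → K < G.dist (g j') (f s) := by
    refine ⟨Nat.find hex, Nat.find_spec hex, fun j' hj' hj'' s hs hsl => ?_⟩
    by_contra! hle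
    exact Nat.find_min hex hj'' ⟨hj', (hj''.le.trans (Nat.find_spec hex).2.1), s, hs, hsl, hle⟩
  -- As `q` stays farther than `3 * K` from `f t`, both `t - s₁` and `s₂ - t` exceed `2 * K`. So `i
  -- ≠ j`, and the connections of length at most `K` at `s₁` and `s₂` are more than `2 * K` apart.
  have d₁ := hf s₁ t hs₁ ht
  have d₂ := hf t s₂ hs₂ hs₂l
  have d₁₂ := hf s₁ s₂ (hs₁.trans hs₂) hs₂l
  have c₁ := (rfg s₁ i).symm.dist_triangle_left (f t)
  have c₂ := (rfg s₂ j).symm.dist_triangle_left (f t)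
  have hci := hgc i
  have hcj := hgc j
  rw [G.dist_comm (u := f s₂) (v := f t)] at c₂
  have hlt : i < j := by
    refine lt_of_le_of_ne hij fun h => ?_
    subst h
    have h1 := (rfg s₁ i).dist_triangle_left (f s₂)
    rw [G.dist_comm (u := f s₁) (v := g i)] at h1
    omega
  have hstep : ∀ k, k < q.length → ∀ s, G.dist (g k) (f s) ≤ G.dist (g (k + 1)) (f s) + 1 ∧
      G.dist (g (k + 1)) (f s) ≤ G.dist (g k) (f s) + 1 := by
    intro k hk s
    have h1 := SimpleGraph.dist_eq_one_iff_adj.2 (hgadj k hk)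
    have h2 := (hgadj k hk).reachable.dist_triangle_left (f s)
    have h3 := (hgadj k hk).reachable.symm.dist_triangle_left (f s)
    rw [G.dist_comm (u := g (k + 1)) (v := g k)] at h3
    omega
  have hgap : ∀ k, i ≤ k → k ≤ j → ∀ s ≤ p.length, F < G.dist (g k) (f s) := by
    intro k hik hkj s hs
    rcases le_total s t with hst | hts
    · rcases hik.lt_or_eq with h | h
      · have := himax k h (by omega) s hst
        omega
      · have h1 := himax (i + 1) (by omega) (by omega) s hst
        have h2 := (hstep i (by omega) s).2
        subst h
        omega
    · rcases hkj.lt_or_eq with h | h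
      · have := hjmin k hik h s hts hs
        omega
      · have h1 := hjmin (j - 1) (by omega) (by omega) s hts hs
        have h2 := (hstep (j - 1) (by omega) s).1
        rw [Nat.sub_add_cancel (by omega)] at h2
        subst h
        omega
  obtain ⟨P, hP, hPf⟩ := exists_walk_of_adj f (hs₁.trans hs₂) fun c _ hc => hf.adj (by omega)
  obtain ⟨Q, hQ, hQg⟩ := exists_walk_of_adj g hlt.le fun c _ hc => hgadj c (by omega)
  obtain ⟨S, hS⟩ := (rfg s₂ j).exists_walk_length_eq_dist
  obtain ⟨T, hT⟩ := (rfg s₁ i).symm.exists_walk_length_eq_dist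
  rw [G.dist_comm] at hjs₂
  rw [G.dist_comm (u := g j) (v := f s₂)] at c₂
  refine hF (p.length + q.length + K) (FatQuadrangle.of_walks P S Q.reverse T (by omega) (by omega)
    (by rw [SimpleGraph.Walk.length_reverse]; omega) (by omega) ?_ ?_)
  · intro x hx y hy
    obtain ⟨c, hac, hcb, rfl⟩ := hPf x hx
    obtain ⟨d, had, hdb, rfl⟩ := hQg y (by simpa using hy)
    refine lt_edist_of_lt_dist ?_
    rw [G.dist_comm]
    exact hgap d had hdb c (by omega)
  · intro x hx y hy
    refine lt_edist_of_lt_dist ?_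
    obtain ⟨h1, h2⟩ := dist_le_of_mem_geodesic S (hS.le.trans hjs₂) hx
    obtain ⟨h3, h4⟩ := dist_le_of_mem_geodesic T.reverse (n := K)
      (by rw [SimpleGraph.Walk.length_reverse]; omega) (w := y) (by simpa using hy)
    have h6 := h3.dist_triangle_left (f s₂)
    have h7 := h1.symm.dist_triangle_right y
    rw [G.dist_comm (u := y) (v := x), G.dist_comm (u := x) (v := f s₂)] at h7
    omega

/-! ### Cops that follow geodesics -/

/-- The strategy of a cop who starts at `v` and moves to `pt (i + 1) x` in stage `i + 1`, where `x`
is the position of the robber, as long as this vertex is within her reach. -/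
noncomputable def followStrategy (G : SimpleGraph V) (sc : ℕ) (v : V) (pt : ℕ → V → V) :
    CopStrategy V 1 := fun h _ =>
  open scoped Classical in
  (h.foldl (fun s x => (s.1 + 1, if G.edist s.2 (pt (s.1 + 1) x) ≤ sc then pt (s.1 + 1) x else s.2))
    ((0 : ℕ), v)).2

theorem followStrategy_append {G : SimpleGraph V} {sc : ℕ} {v : V} {pt : ℕ → V → V} (h : List V)
    (x : V) (j : Fin 1) : followStrategy G sc v pt (h ++ [x]) j =
      open scoped Classical in
      if G.edist (followStrategy G sc v pt h j) (pt (h.length + 1) x) ≤ sc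
        then pt (h.length + 1) x else followStrategy G sc v pt h j := by
  classical
  have hlen : ∀ (h : List V) (s : ℕ × V), (h.foldl (fun s x => (s.1 + 1,
      if G.edist s.2 (pt (s.1 + 1) x) ≤ sc then pt (s.1 + 1) x else s.2)) s).1
        = s.1 + h.length := by
    intro h
    induction h with
    | nil => simp
    | cons y h ih => intro s; rw [List.foldl_cons, ih, List.length_cons]; simp only; omega
  have hl := hlen h (0, v)
  simp only [Nat.zero_add] at hl
  simp only [followStrategy, List.foldl_append, List.foldl_cons, List.foldl_nil, hl]
  congr

/-- The test in the definition enforces the speed bound even for histories that no robber can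
produce. -/
theorem followStrategy_hasSpeed {G : SimpleGraph V} {sc : ℕ} {v : V} {pt : ℕ → V → V} :
    (followStrategy G sc v pt).HasSpeed G sc := by
  intro h x j
  rw [followStrategy_append]
  split_ifs with hc
  · exact hc
  · simp

/-- The cop drives the robber away if the vertices that she wants to visit are at bounded distance
from each other. -/
theorem copsCanForce_of_follow {G : SimpleGraph V} {sc ρ sr : ℕ} {v : V} (pt : ℕ → V → V)
    (hstart : ∀ x, G.edist v (pt 1 x) ≤ sc)
    (hnext : ∀ i x y, (ρ : ℕ∞) < G.edist x (pt (i + 1) x) →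
      RobberMove G ρ sr (fun _ : Fin 1 => pt (i + 1) x) x y →
        G.edist (pt (i + 1) x) (pt (i + 2) y) ≤ sc)
    (haway : ∀ (i : ℕ) x, (ρ : ℕ∞) < G.edist x (pt (i + 1) x) → (i : ℕ∞) < G.edist v x) :
    CopsCanForce G 1 sc ρ sr fun r => ∀ R : ℕ, ∃ N : ℕ, ∀ i ≥ N, (R : ℕ∞) < G.edist v (r i) := by
  refine ⟨followStrategy G sc v pt, followStrategy_hasSpeed, fun r hr => ?_⟩
  have hsucc : ∀ i, (followStrategy G sc v pt).pos r (i + 1) =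
      followStrategy G sc v pt ((List.range i).map r ++ [r i]) := fun i => by
    rw [CopStrategy.pos, List.range_succ, List.map_append, List.map_singleton]
  have hpos : ∀ i, (followStrategy G sc v pt).pos r (i + 1) = fun _ => pt (i + 1) (r i) := by
    intro i
    induction i with
    | zero =>
      funext j
      rw [hsucc, followStrategy_append]
      exact if_pos (hstart (r 0))
    | succ i ih =>
      funext j
      obtain ⟨h1, h2⟩ := hr i
      rw [ih] at h1 h2
      have h3 := hnext i (r i) (r (i + 1)) (h1 0) h2
      rw [hsucc, followStrategy_append, List.length_map, List.length_range]
      refine if_pos ?_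
      change G.edist ((followStrategy G sc v pt).pos r (i + 1) j) _ ≤ _
      rw [ih]
      exact h3
  have hlt : ∀ i : ℕ, (i : ℕ∞) < G.edist v (r i) := fun i => haway i (r i) (by
    have := (hr i).1 0
    rwa [hpos] at this)
  exact fun R => ⟨R, fun i hi => lt_of_le_of_lt (Nat.cast_le.2 hi) (hlt i)⟩

/-- It suffices to bound the distance between corresponding points of two geodesics. -/
theorem copsCanForce_of_geodesics {G : SimpleGraph V} {sc ρ sr : ℕ} (hsc : 0 < sc) (v : V)
    (hnext : ∀ (x y : V) (p : G.Walk v x) (q : G.Walk v y), p.length = G.dist v x →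
      q.length = G.dist v y → ∀ t, t + ρ < p.length →
        RobberMove G ρ sr (fun _ : Fin 1 => p.getVert t) x y →
          G.dist (p.getVert t) (q.getVert (t + 1)) ≤ sc) :
    CopsCanForce G 1 sc ρ sr fun r => ∀ R : ℕ, ∃ N : ℕ, ∀ i ≥ N, (R : ℕ∞) < G.edist v (r i) := by
  classical
  have hgeo : ∀ x, G.Reachable v x → ∃ p : G.Walk v x, p.length = G.dist v x := fun x hx =>
    hx.exists_walk_length_eq_dist
  choose geo hgeo using hgeo
  let pt : ℕ → V → V := fun t x => if hx : G.Reachable v x then (geo x hx).getVert t else v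
  have hpt : ∀ t x (hx : G.Reachable v x), pt t x = (geo x hx).getVert t := fun t x hx => dif_pos hx
  have hpt' : ∀ t x, ¬ G.Reachable v x → pt t x = v := fun t x hx => dif_neg hx
  have hlen : ∀ t x (hx : G.Reachable v x), (ρ : ℕ∞) < G.edist x (pt t x) →
      t + ρ < (geo x hx).length := by
    intro t x hx h
    rw [hpt t x hx, ← (hx.symm.trans (reachable_getVert _ t)).coe_dist_eq_edist] at h
    have h' : ρ < G.dist x ((geo x hx).getVert t) := by exact_mod_cast h
    rcases le_total t (geo x hx).length with hle | hle
    · have := dist_getVert_le (geo x hx) hle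
      rw [SimpleGraph.Walk.getVert_length, G.dist_comm] at this
      omega
    · rw [SimpleGraph.Walk.getVert_of_length_le _ hle, SimpleGraph.dist_self] at h'
      omega
  refine copsCanForce_of_follow pt (fun x => ?_) (fun i x y hx hmove => ?_) (fun i x hx => ?_)
  · by_cases hx : G.Reachable v x
    · have := dist_getVert_le (geo x hx) (Nat.zero_le 1)
      rw [SimpleGraph.Walk.getVert_zero] at this
      rw [hpt 1 x hx, ← (reachable_getVert _ 1).coe_dist_eq_edist]
      exact_mod_cast by omega
    · simp [hpt' 1 x hx]
  · have hxy : G.Reachable x y := hmove.choose.reachable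
    by_cases hvx : G.Reachable v x
    · have hvy := hvx.trans hxy
      have h1 := hlen _ _ hvx hx
      rw [hpt _ x hvx] at hmove ⊢
      rw [hpt _ y hvy,
        ← ((reachable_getVert _ _).symm.trans (reachable_getVert _ _)).coe_dist_eq_edist]
      exact_mod_cast hnext x y _ _ (hgeo x hvx) (hgeo y hvy) (i + 1) h1 hmove
    · have hvy : ¬ G.Reachable v y := fun h => hvx (h.trans hxy.symm)
      simp [hpt' _ _ hvx, hpt' _ _ hvy]
  · by_cases hvx : G.Reachable v x
    · have h1 := hlen _ _ hvx hx
      rw [hgeo x hvx] at h1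
      exact lt_edist_of_lt_dist (by omega)
    · rw [SimpleGraph.edist_eq_top_of_not_reachable hvx]
      exact ENat.natCast_lt_top i

/-! ### From the divergence game to the original game -/

/-- One cop can drive the robber away from every vertex. -/
def DrivesAway (G : SimpleGraph V) (sc ρ sr : ℕ) : Prop :=
  ∀ v : V, CopsCanForce G 1 sc ρ sr fun r => ∀ R : ℕ, ∃ N : ℕ, ∀ i ≥ N, (R : ℕ∞) < G.edist v (r i)

theorem CopsCanForce.mono {G : SimpleGraph V} {k sc ρ sr : ℕ} {p q : (ℕ → V) → Prop}
    (h : CopsCanForce G k sc ρ sr p) (hpq : ∀ r, p r → q r) : CopsCanForce G k sc ρ sr q := by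
  obtain ⟨σ, hσ, hwin⟩ := h
  exact ⟨σ, hσ, fun r hr => hpq r (hwin r hr)⟩

theorem DrivesAway.copWin {G : SimpleGraph V} {sc ρ sr : ℕ} (h : DrivesAway G sc ρ sr) (R : ℕ) :
    CopWin G 1 sc ρ sr R :=
  fun v => (h v).mono fun _ hr => hr R

theorem DrivesAway.unannouncedDivWin {G : SimpleGraph V} {sc ρ sr : ℕ} (h : DrivesAway G sc ρ sr) :
    UnannouncedDivWin G 1 sc ρ sr :=
  fun v => (h v).mono fun _ hr R => (hr R).imp fun N hN => hN N le_rfl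

theorem CopWin.divWin {G : SimpleGraph V} {k sc ρ sr R : ℕ} (h : CopWin G k sc ρ sr R) :
    DivWin G k sc ρ sr R :=
  fun v => (h v).mono fun _ ⟨N, hN⟩ => ⟨N, hN N le_rfl⟩

theorem UnannouncedDivWin.divWin {G : SimpleGraph V} {k sc ρ sr : ℕ}
    (h : UnannouncedDivWin G k sc ρ sr) (R : ℕ) : DivWin G k sc ρ sr R :=
  fun v => (h v).mono fun _ hr => hr R

/-- The new geodesic followed by the reversed robber move must come within `D` of the cop. The move
does not, so the new geodesic does, at a time differing from `t` by at most `D`. This gives speed `2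
* D + 1`, whatever the robber's speed. -/
theorem exists_drivesAway_of_not_fatQuadrangle {G : SimpleGraph V} {F : ℕ}
    (hF : ∀ L, ¬ FatQuadrangle G F L) : ∃ sc > 0, ∃ ρ, ∀ sr, DrivesAway G sc ρ sr := by
  set D := 3 * (F + 1) with hD
  refine ⟨2 * D + 1, by omega, D, fun sr v => copsCanForce_of_geodesics (by omega) v
    fun x y p q hp hq t ht ⟨m, _, _, hm⟩ => ?_⟩
  obtain ⟨z, hz, hzD⟩ := exists_mem_support_dist_le hF hp (q.append m.reverse) (t := t) (by omega)
  have hzr : G.Reachable z (p.getVert t) := by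
    classical
    exact ((q.append m.reverse).takeUntil z hz).reachable.symm.trans (reachable_getVert p t)
  have hzq : z ∈ q.support := by
    rw [SimpleGraph.Walk.mem_support_append_iff] at hz
    refine hz.resolve_right fun hzm => ?_
    have := hm z (by simpa using hzm) 0
    rw [← hzr.coe_dist_eq_edist] at this
    have : D < G.dist z (p.getVert t) := by exact_mod_cast this
    omega
  obtain ⟨s, rfl, hs⟩ := SimpleGraph.Walk.mem_support_iff_exists_getVert.1 hzq
  have h1 := isGeodesicUpTo_getVert hp 0 t (by omega) (by omega)
  have h2 := isGeodesicUpTo_getVert hq 0 s (by omega) hs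
  rw [SimpleGraph.Walk.getVert_zero] at h1 h2
  have h3 := hzr.dist_triangle_right v
  have h4 := hzr.symm.dist_triangle_right v
  have h5 := hzr.symm.dist_triangle_left (q.getVert (t + 1))
  rw [G.dist_comm (u := p.getVert t) (v := q.getVert s)] at h4 h5
  rcases le_total s (t + 1) with h | h
  · have := dist_getVert_le q h
    omega
  · have := dist_getVert_le q h
    rw [G.dist_comm] at this
    omega

/-- Cut to their common length, the two geodesics end within `2 * sr` of each other. A reach of `321
* sr` places the cop at least `320 * sr` before these ends, where the width is at most `D`; one more
step gives `D + 1`. -/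
theorem drivesAway_of_not_fatQuadrangle {G : SimpleGraph V} {D : ℕ} (hD : 64 ≤ D)
    (hF : ∀ K ≥ D, ¬ FatQuadrangle G (6 * K / 64) (40 * K)) (sr : ℕ) :
    DrivesAway G (D + 1) (321 * sr) sr := by
  refine fun v => copsCanForce_of_geodesics (by omega) v
    fun x y p q hp hq t ht ⟨m, _, hm, _⟩ => ?_
  have hxy : G.dist x y ≤ sr := (SimpleGraph.dist_le m).trans hm
  have h1 := p.reachable.dist_triangle_left y
  have h2 := q.reachable.dist_triangle_left x
  rw [G.dist_comm (u := y) (v := x)] at h2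
  have hend : ∀ l, l ≤ p.length → l ≤ q.length → (l = p.length ∨ l = q.length) →
      G.dist (p.getVert l) (q.getVert l) ≤ 2 * sr := by
    intro l hlp hlq hl
    rcases hl with rfl | rfl
    · have h3 := dist_getVert_le q hlq
      have h4 := m.reachable.dist_triangle_left (q.getVert p.length)
      rw [SimpleGraph.Walk.getVert_length] at h3 ⊢
      rw [G.dist_comm] at h3
      omega
    · have h3 := dist_getVert_le p hlp
      have h4 := m.reachable.dist_triangle_right (p.getVert q.length)
      rw [SimpleGraph.Walk.getVert_length] at h3 ⊢
      omega
  have hthin : G.dist (p.getVert t) (q.getVert t) ≤ D := by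
    by_contra! hlt
    obtain ⟨K, hK, hquad⟩ := exists_fatQuadrangle_of_geodesics (l := min p.length q.length)
      ((isGeodesicUpTo_getVert hp).mono (min_le_left _ _))
      ((isGeodesicUpTo_getVert hq).mono (min_le_right _ _)) (by simp)
      (hend _ (min_le_left _ _) (min_le_right _ _) (by omega)) (t₀ := t) (by omega) hlt.le hD
    exact hF K hK hquad
  have h3 := dist_getVert_le q (show t ≤ t + 1 by omega)
  have h4 := ((reachable_getVert p t).symm.trans (reachable_getVert q t)).dist_triangle_left
    (q.getVert (t + 1))
  omega

theorem exists_drivesAway_of_weak_divWin {G : SimpleGraph V}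
    (h : ∃ sc > 0, ∃ ρ, ∀ sr > 0, ∀ R > 0, DivWin G 1 sc ρ sr R) :
    ∃ sc > 0, ∃ ρ, ∀ sr, DrivesAway G sc ρ sr := by
  obtain ⟨sc, hsc, ρ, h⟩ := h
  -- The robber picks his speed after `sc` and `ρ`, so he can pass a side of any length in one
  -- stage.
  refine exists_drivesAway_of_not_fatQuadrangle (F := 2 * (ρ + 2 * (1 * sc))) fun L hL => ?_
  obtain ⟨R, hR, hnot⟩ := exists_not_divWin_of_fatQuadrangle (sr := L + 1) one_pos
    (hL.mono le_rfl (by omega))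
  exact hnot (h _ (by omega) R hR)

theorem exists_drivesAway_of_strong_divWin {G : SimpleGraph V}
    (h : ∃ sc > 0, ∀ sr > 0, ∃ ρ, ∀ R > 0, DivWin G 1 sc ρ sr R) :
    ∃ sc > 0, ∀ sr, ∃ ρ, DrivesAway G sc ρ sr := by
  obtain ⟨sc, hsc, h⟩ := h
  -- One robber speed suffices. With `T = K / (64 * sc)` rounded down and `T ≥ ρ + 1`, one has `K <
  -- 128 * (T * sc)`, so `40 * K ≤ T * (5120 * sc)`. The required fatness is at most `6 * (T * sc) ≤
  -- 6 * K / 64`.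
  obtain ⟨ρ, h⟩ := h (5120 * sc) (by omega)
  have hD : 64 ≤ 64 * sc * (ρ + 1) := by nlinarith
  refine ⟨64 * sc * (ρ + 1) + 1, by omega, fun sr => ⟨321 * sr,
    drivesAway_of_not_fatQuadrangle hD (fun K hK hquad => ?_) sr⟩⟩
  -- the number of stages in which the robber passes one side of the quadrangle
  set T := K / (64 * sc) with hT
  have hT1 : ρ + 1 ≤ T := (Nat.le_div_iff_mul_le (by omega)).2 (by rwa [mul_comm])
  have hT2 : 64 * sc * T ≤ K := Nat.mul_div_le _ _
  have hT3 : K < 64 * sc * (T + 1) := by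
    have := Nat.lt_div_mul_add (a := K) (b := 64 * sc) (by omega)
    rw [← hT] at this
    linarith
  have hTsc : T ≤ T * sc := Nat.le_mul_of_pos_right _ hsc
  have hsT : 64 * sc * T = 64 * (T * sc) := by ring
  have hscT : sc ≤ T * sc := Nat.le_mul_of_pos_left _ (by omega)
  have hsT' : 64 * sc * (T + 1) = 64 * (T * sc) + 64 * sc := by ring
  have hlen : T * (5120 * sc) = 5120 * (T * sc) := by ring
  obtain ⟨R, hR, hnot⟩ := exists_not_divWin_of_fatQuadrangle (sc := sc) (ρ := ρ) (sr := 5120 * sc)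
    (T := T) (by omega) (hquad.mono (by omega) (by omega))
  exact hnot (h R hR)

/-! ### Cop numbers equal to one -/

theorem iInf_natCast_eq_one_iff (C : ℕ → Prop) :
    (⨅ (k : ℕ) (_ : C k), (k : ℕ∞)) = 1 ↔ ¬ C 0 ∧ C 1 := by
  constructor
  · intro h
    have h0 : ¬ C 0 := fun h0 => by
      have : (⨅ (k : ℕ) (_ : C k), (k : ℕ∞)) ≤ (0 : ℕ) := iInf₂_le 0 h0
      rw [h] at this
      simp at this
    refine ⟨h0, by_contra fun h1 => ?_⟩
    have : ((2 : ℕ) : ℕ∞) ≤ ⨅ (k : ℕ) (_ : C k), (k : ℕ∞) := le_iInf₂ fun k hk => by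
      have : k ≠ 0 := fun h => h0 (h ▸ hk)
      have : k ≠ 1 := fun h => h1 (h ▸ hk)
      exact_mod_cast (by omega : 2 ≤ k)
    rw [h] at this
    exact absurd this (by norm_num)
  · rintro ⟨h0, h1⟩
    refine le_antisymm (by simpa using iInf₂_le (f := fun (k : ℕ) (_ : C k) => (k : ℕ∞)) 1 h1)
      (le_iInf₂ fun k hk => ?_)
    have : k ≠ 0 := fun h => h0 (h ▸ hk)
    exact_mod_cast (by omega : 1 ≤ k)

/-- Without cops the robber can stay where he is. -/
theorem not_copsCanForce_zero {G : SimpleGraph V} {sc ρ sr : ℕ} {p : (ℕ → V) → Prop} {v : V}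
    (hp : ¬ p fun _ => v) : ¬ CopsCanForce G 0 sc ρ sr p := by
  rintro ⟨σ, -, hwin⟩
  exact hp (hwin _ fun i => ⟨fun j => j.elim0, .nil, by simp, by simp, fun _ _ j => j.elim0⟩)

theorem not_divWin_zero [Nonempty V] {G : SimpleGraph V} {sc ρ sr R : ℕ} :
    ¬ DivWin G 0 sc ρ sr R := fun h =>
  not_copsCanForce_zero (v := Classical.arbitrary V) (by simp) (h (Classical.arbitrary V))

/-- On the empty graph all games are won vacuously and the number is 0; otherwise a stationary
robber beats zero cops. -/
theorem strong_zero_iff_isEmpty {G : SimpleGraph V} {win : ℕ → ℕ → ℕ → ℕ → ℕ → Prop}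
    (hdiv : ∀ k sc ρ sr R, win k sc ρ sr R → DivWin G k sc ρ sr R)
    (hempty : IsEmpty V → ∀ k sc ρ sr R, win k sc ρ sr R) :
    (∃ sc > 0, ∀ sr > 0, ∃ ρ, ∀ R > 0, win 0 sc ρ sr R) ↔ IsEmpty V := by
  refine ⟨fun ⟨sc, _, h⟩ => ?_, fun hV => ⟨1, one_pos, fun _ _ => ⟨0, fun _ _ => hempty hV ..⟩⟩⟩
  obtain ⟨ρ, h⟩ := h 1 one_pos
  by_contra hV
  rw [not_isEmpty_iff] at hV
  exact not_divWin_zero (hdiv _ _ _ _ _ (h 1 one_pos))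

theorem weak_zero_iff_isEmpty {G : SimpleGraph V} {win : ℕ → ℕ → ℕ → ℕ → ℕ → Prop}
    (hdiv : ∀ k sc ρ sr R, win k sc ρ sr R → DivWin G k sc ρ sr R)
    (hempty : IsEmpty V → ∀ k sc ρ sr R, win k sc ρ sr R) :
    (∃ sc > 0, ∃ ρ, ∀ sr > 0, ∀ R > 0, win 0 sc ρ sr R) ↔ IsEmpty V := by
  refine ⟨fun ⟨sc, _, ρ, h⟩ => ?_, fun hV => ⟨1, one_pos, 0, fun _ _ _ _ => hempty hV ..⟩⟩
  by_contra hV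
  rw [not_isEmpty_iff] at hV
  exact not_divWin_zero (hdiv _ _ _ _ _ (h 1 one_pos 1 one_pos))

/-- The strong number of a game between the divergence game and the game in which the cop has to
drive the robber away is one if and only if one cop can drive the robber away. -/
theorem strongNumber_eq_one_iff {G : SimpleGraph V} {win : ℕ → ℕ → ℕ → ℕ → ℕ → Prop}
    (hdiv : ∀ k sc ρ sr R, win k sc ρ sr R → DivWin G k sc ρ sr R)
    (hempty : IsEmpty V → ∀ k sc ρ sr R, win k sc ρ sr R)
    (haway : ∀ sc ρ sr R, DrivesAway G sc ρ sr → win 1 sc ρ sr R) :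
    strongNumber win = 1 ↔ ¬ IsEmpty V ∧ ∃ sc > 0, ∀ sr, ∃ ρ, DrivesAway G sc ρ sr := by
  rw [strongNumber, iInf_natCast_eq_one_iff, strong_zero_iff_isEmpty hdiv hempty]
  refine and_congr_right fun _ => ⟨fun ⟨sc, hsc, h⟩ => exists_drivesAway_of_strong_divWin
    ⟨sc, hsc, fun sr hsr => (h sr hsr).imp fun ρ h R hR => hdiv _ _ _ _ _ (h R hR)⟩, ?_⟩
  exact fun ⟨sc, hsc, h⟩ => ⟨sc, hsc, fun sr _ => (h sr).imp fun ρ h R _ => haway _ _ _ _ h⟩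

/-- The weak number of a game between the divergence game and the game in which the cop has to
drive the robber away is one if and only if one cop can drive the robber away. -/
theorem weakNumber_eq_one_iff {G : SimpleGraph V} {win : ℕ → ℕ → ℕ → ℕ → ℕ → Prop}
    (hdiv : ∀ k sc ρ sr R, win k sc ρ sr R → DivWin G k sc ρ sr R)
    (hempty : IsEmpty V → ∀ k sc ρ sr R, win k sc ρ sr R)
    (haway : ∀ sc ρ sr R, DrivesAway G sc ρ sr → win 1 sc ρ sr R) :
    weakNumber win = 1 ↔ ¬ IsEmpty V ∧ ∃ sc > 0, ∃ ρ, ∀ sr, DrivesAway G sc ρ sr := by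
  rw [weakNumber, iInf_natCast_eq_one_iff, weak_zero_iff_isEmpty hdiv hempty]
  refine and_congr_right fun _ => ⟨fun ⟨sc, hsc, ρ, h⟩ => exists_drivesAway_of_weak_divWin
    ⟨sc, hsc, ρ, fun sr hsr R hR => hdiv _ _ _ _ _ (h sr hsr R hR)⟩, ?_⟩
  exact fun ⟨sc, hsc, ρ, h⟩ => ⟨sc, hsc, ρ, fun sr _ R _ => haway _ _ _ _ (h sr)⟩

end CoarseCops

theorem theorem7p2 {V : Type*} (G : SimpleGraph V) :
    ((CoarseCops.sdi G = 1 ↔ CoarseCops.sco G = 1) ∧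
      (CoarseCops.wdi G = 1 ↔ CoarseCops.wco G = 1)) ∧
    ((CoarseCops.sdiUnannounced G = 1 ↔ CoarseCops.sco G = 1) ∧
      (CoarseCops.wdiUnannounced G = 1 ↔ CoarseCops.wco G = 1)) := by
  have c₁ : ∀ k sc ρ sr R, CoarseCops.CopWin G k sc ρ sr R → CoarseCops.DivWin G k sc ρ sr R :=
    fun _ _ _ _ _ h => h.divWin
  have c₂ : IsEmpty V → ∀ k sc ρ sr R, CoarseCops.CopWin G k sc ρ sr R :=
    fun hV _ _ _ _ _ v => hV.elim v
  have c₃ : ∀ sc ρ sr R, CoarseCops.DrivesAway G sc ρ sr → CoarseCops.CopWin G 1 sc ρ sr R :=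
    fun _ _ _ R h => h.copWin R
  have d₁ : ∀ k sc ρ sr R, CoarseCops.DivWin G k sc ρ sr R → CoarseCops.DivWin G k sc ρ sr R :=
    fun _ _ _ _ _ h => h
  have d₂ : IsEmpty V → ∀ k sc ρ sr R, CoarseCops.DivWin G k sc ρ sr R :=
    fun hV _ _ _ _ _ v => hV.elim v
  have d₃ : ∀ sc ρ sr R, CoarseCops.DrivesAway G sc ρ sr → CoarseCops.DivWin G 1 sc ρ sr R :=
    fun _ _ _ R h => (h.copWin R).divWin
  have u₁ : ∀ k sc ρ sr R, CoarseCops.UnannouncedDivWin G k sc ρ sr →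
      CoarseCops.DivWin G k sc ρ sr R := fun _ _ _ _ R h => h.divWin R
  have u₂ : IsEmpty V → ∀ k sc ρ sr (_ : ℕ), CoarseCops.UnannouncedDivWin G k sc ρ sr :=
    fun hV _ _ _ _ _ v => hV.elim v
  have u₃ : ∀ sc ρ sr (_ : ℕ), CoarseCops.DrivesAway G sc ρ sr →
      CoarseCops.UnannouncedDivWin G 1 sc ρ sr := fun _ _ _ _ h => h.unannouncedDivWin
  rw [CoarseCops.sdi, CoarseCops.sco, CoarseCops.wdi, CoarseCops.wco, CoarseCops.sdiUnannounced,
    CoarseCops.wdiUnannounced, CoarseCops.strongNumber_eq_one_iff c₁ c₂ c₃,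
    CoarseCops.strongNumber_eq_one_iff d₁ d₂ d₃, CoarseCops.strongNumber_eq_one_iff u₁ u₂ u₃,
    CoarseCops.weakNumber_eq_one_iff c₁ c₂ c₃, CoarseCops.weakNumber_eq_one_iff d₁ d₂ d₃,
    CoarseCops.weakNumber_eq_one_iff u₁ u₂ u₃]
  exact ⟨⟨.rfl, .rfl⟩, .rfl, .rfl⟩
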